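/- An instance $I=(V,\mathcal C,k)$ of weighted 3-Linear Ordering consists of a finite set $V$ of $n$ variables, a finite collection $\mathcal C$ (repetitions allowed) of constraints, and an integer $k\ge 0$. Each constraint $e$ is an ordered pair $(v_1,v_2)$ or an ordered triple $(v_1,v_2,v_3)$ of distinct variables, and has a nonnegative integer weight $w(e)$. A linear ordering is a bijection $\phi:V\to\{1,\dots,n\}$; it satisfies $(v_1,v_2)$ if $\phi(v_1)<\phi(v_2)$, and $(v_1,v_2,v_3)$ if $\phi(v_1)<\phi(v_2)<\phi(v_3)$. Let $w(\phi,\mathcal C)$ be the total weight of the constraints satisfied by $\phi$, let $W$ be the total weight of all constraints, and let $\rho$ be the expected fraction of the total weight that is satisfied by a uniformly random linear ordering. The instance is a yes-instance if some linear ordering $\phi$ has $w(\phi,\mathcal C)\ge \rho W+\frac{k}{3!\,4^3}$, and a no-instance otherwise. The instance is irreducible if none of the following five rules can be applied to it. 1. Redundancy: remove a variable that appears in no constraint; remove a constraint of weight zero. 2. Merging: replace two identical constraints of weights $w_1,w_2$ by a single one of weight $w_1+w_2$. 3. Cancellation: given constraints $e_1=(u,v)$ and $e_2=(v,u)$, subtract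 $\min\{w(e_1),w(e_2)\}$ from both weights. 4. Edge replacement: given constraints $e_1=(a,b,c)$, $e_2=(b,a,c)$, $e_3=(a,c,b)$, subtract $w_{\min}=\min_i w(e_i)$ from the three weights and add the constraint $(a,c)$ with weight $w_{\min}$. 5. Cycle replacement: given constraints $e_1=(a,b,c)$, $e_2=(b,c,a)$, $e_3=(c,a,b)$, subtract $w_{\min}=\min_i w(e_i)$ from the three weights and add the constraints $(a,b)$, $(b,c)$, $(c,a)$, each with weight $w_{\min}$. **Theorem.** If $I=(V,\mathcal C,k)$ is an irreducible no-instance of weighted 3-Linear Ordering, then $|V|<15k$. -/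

import Mathlib

/-- An ordering constraint over variables of type `α`: an ordered pair or an ordered triple. -/
inductive OrdConstraint (α : Type*) where
  | two (u v : α) : OrdConstraint α
  | three (u v w : α) : OrdConstraint α

namespace OrdConstraint

variable {α : Type*}

/-- The tuple of variables of a constraint. -/
def tuple : OrdConstraint α → List α
  | two u v => [u, v]
  | three u v w => [u, v, w]

/-- A constraint is satisfied by an assignment `p` of positions if the positions of its
variables are strictly increasing along the tuple. -/
def Sat (p : α → ℕ) : OrdConstraint α → Prop
  | two u v => p u < p v
  | three u v w => p u < p v ∧ p v < p w

instance decidableSat (p : α → ℕ) : ∀ e : OrdConstraint α, Decidable (e.Sat p)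
  | two u v => inferInstanceAs (Decidable (p u < p v))
  | three u v w => inferInstanceAs (Decidable (p u < p v ∧ p v < p w))

end OrdConstraint

/-- An instance `(V, C, k)` of weighted 3-Linear Ordering: a finite set of variables, a finite
collection (repetitions allowed) of weighted constraints, each of them a tuple of two or three
distinct variables with a nonnegative integer weight, and the parameter `k`. -/
structure LinOrd3 (α : Type*) where
  vars : Finset α
  constraints : Multiset (OrdConstraint α × ℕ)
  k : ℕ
  mem_vars : ∀ c ∈ constraints, ∀ x ∈ c.1.tuple, x ∈ vars
  nodup : ∀ c ∈ constraints, c.1.tuple.Nodup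

namespace LinOrd3

variable {α : Type*}

/-- Linear orderings of the variables: bijections from `V` onto `n` positions, `n = |V|`. -/
abbrev Ordering (I : LinOrd3 α) : Type _ := {x // x ∈ I.vars} ≃ Fin I.vars.card

/-- The position in `{1, …, n}` of a variable (and `0`, never used, outside `V`). -/
def pos [DecidableEq α] (I : LinOrd3 α) (φ : I.Ordering) (x : α) : ℕ :=
  if h : x ∈ I.vars then (φ ⟨x, h⟩ : ℕ) + 1 else 0

/-- `w(φ, C)`: the total weight of the constraints satisfied by `φ`. -/
def weight [DecidableEq α] (I : LinOrd3 α) (φ : I.Ordering) : ℕ :=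
  (I.constraints.map fun c => if c.1.Sat (I.pos φ) then c.2 else 0).sum

/-- `W`: the total weight of all constraints. -/
def totalWeight (I : LinOrd3 α) : ℕ := (I.constraints.map fun c => c.2).sum

/-- `ρ`: the expected fraction of the total weight that is satisfied by a uniformly random
linear ordering (`0` if the total weight is `0`). -/
def rho [DecidableEq α] (I : LinOrd3 α) : ℚ :=
  (∑ φ : I.Ordering, (I.weight φ : ℚ) / I.totalWeight) / Fintype.card I.Ordering

/-- Above-average parameterization, with arity `c = 3`: the instance is a yes-instance if some
linear ordering has weight at least `ρ W + k / (c! 4 ^ c)`. -/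
def IsYes [DecidableEq α] (I : LinOrd3 α) : Prop :=
  ∃ φ : I.Ordering,
    I.rho * I.totalWeight + (I.k : ℚ) / ((Nat.factorial 3 : ℚ) * 4 ^ 3) ≤ I.weight φ

/-- A no-instance: every linear ordering has weight less than `ρ W + k / (c! 4 ^ c)`. -/
def IsNo [DecidableEq α] (I : LinOrd3 α) : Prop := ¬ I.IsYes

open OrdConstraint

/-- Redundancy Rule: remove a variable that appears in no constraint, or remove a constraint of
weight zero. -/
inductive Redundancy [DecidableEq α] (I J : LinOrd3 α) : Prop
  | removeVar (v : α) (hv : v ∈ I.vars) (hfree : ∀ c ∈ I.constraints, v ∉ c.1.tuple)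
      (hV : J.vars = I.vars.erase v) (hC : J.constraints = I.constraints) (hk : J.k = I.k)
  | removeConstraint (e : OrdConstraint α) (C : Multiset (OrdConstraint α × ℕ))
      (hI : I.constraints = (e, 0) ::ₘ C)
      (hV : J.vars = I.vars) (hC : J.constraints = C) (hk : J.k = I.k)

/-- Merging Rule: replace two identical constraints by one that carries the sum of the weights. -/
inductive Merging (I J : LinOrd3 α) : Prop
  | mk (e : OrdConstraint α) (w₁ w₂ : ℕ) (C : Multiset (OrdConstraint α × ℕ))
      (hI : I.constraints = (e, w₁) ::ₘ (e, w₂) ::ₘ C)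
      (hV : J.vars = I.vars) (hC : J.constraints = (e, w₁ + w₂) ::ₘ C) (hk : J.k = I.k)

/-- Cancellation Rule: for `e₁ = (u, v)` and `e₂ = (v, u)`, subtract the smaller weight from both
weights. -/
inductive Cancellation (I J : LinOrd3 α) : Prop
  | mk (u v : α) (w₁ w₂ m : ℕ) (hm : m = min w₁ w₂) (C : Multiset (OrdConstraint α × ℕ))
      (hI : I.constraints = (two u v, w₁) ::ₘ (two v u, w₂) ::ₘ C)
      (hV : J.vars = I.vars)
      (hC : J.constraints = (two u v, w₁ - m) ::ₘ (two v u, w₂ - m) ::ₘ C) (hk : J.k = I.k)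

/-- Edge Replacement Rule: for `e₁ = (a, b, c)`, `e₂ = (b, a, c)`, `e₃ = (a, c, b)`, subtract the
minimum weight `m` from the three weights and add `(a, c)` with weight `m`. -/
inductive EdgeReplacement (I J : LinOrd3 α) : Prop
  | mk (a b c : α) (w₁ w₂ w₃ m : ℕ) (hm : m = min w₁ (min w₂ w₃))
      (C : Multiset (OrdConstraint α × ℕ))
      (hI : I.constraints =
        (three a b c, w₁) ::ₘ (three b a c, w₂) ::ₘ (three a c b, w₃) ::ₘ C)
      (hV : J.vars = I.vars)
      (hC : J.constraints =
        (three a b c, w₁ - m) ::ₘ (three b a c, w₂ - m) ::ₘ (three a c b, w₃ - m) ::ₘ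
          (two a c, m) ::ₘ C)
      (hk : J.k = I.k)

/-- Cycle Replacement Rule: for `e₁ = (a, b, c)`, `e₂ = (b, c, a)`, `e₃ = (c, a, b)`, subtract the
minimum weight `m` from the three weights and add `(a, b)`, `(b, c)`, `(c, a)` with weight `m`
each. -/
inductive CycleReplacement (I J : LinOrd3 α) : Prop
  | mk (a b c : α) (w₁ w₂ w₃ m : ℕ) (hm : m = min w₁ (min w₂ w₃))
      (C : Multiset (OrdConstraint α × ℕ))
      (hI : I.constraints =
        (three a b c, w₁) ::ₘ (three b c a, w₂) ::ₘ (three c a b, w₃) ::ₘ C)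
      (hV : J.vars = I.vars)
      (hC : J.constraints =
        (three a b c, w₁ - m) ::ₘ (three b c a, w₂ - m) ::ₘ (three c a b, w₃ - m) ::ₘ
          (two a b, m) ::ₘ (two b c, m) ::ₘ (two c a, m) ::ₘ C)
      (hk : J.k = I.k)

/-- An instance is irreducible if none of the five reduction rules can be applied to it. -/
def Irreducible [DecidableEq α] (I : LinOrd3 α) : Prop :=
  ∀ J : LinOrd3 α, ¬ Redundancy I J ∧ ¬ Merging I J ∧ ¬ Cancellation I J ∧
    ¬ EdgeReplacement I J ∧ ¬ CycleReplacement I J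

end LinOrd3

/-!
A linear ordering is drawn at random as follows: every variable gets a label in `ZMod 3`, the labels
are compared through their representatives `0, 1, 2`, and ties are broken by a uniformly random
ordering. With uniform labels every constraint is satisfied with its average probability, so an
ordering above average comes from a suitable nonuniform distribution of the labels.

The density used is a product `∏ (1 + G e)` over a family `F` of variable sets, where the tilt `G e`
depends only on the labels on `e` and averages to zero over each of them. Let `H` be a set of
variables such that the sets `e \ H`, for `e ∈ F`, are nonempty, disjoint and at least as large as
`s \ H` for any variable set `s` of a constraint, and let the members of `F` be maximal among these
variable sets. Then, in the expansion of the product, the term of a subfamily other than `{s}` has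
mean zero against a centred function of the labels on `s` (`labelMean_prod_tilt_mul`), and the gains
of the single tilts add up (`LinOrd3.exists_ordering_of_tilts`).

In an irreducible instance every maximal variable set has a tilt with gain at least `1 / 27`
(`LinOrd3.Irreducible.exists_tilt`). A maximal pair carries just one
constraint, because opposite pairs cancel. On a triple, the tilt
favouring one variable as the middle one gains weight unless each of the three variables is in the
middle with the same total weight. In that case each of the three pairs of mutually reverse orders
occurs, and any choice of one order from each pair is reducible by edge or cycle replacement
(`LinOrd3.Irreducible.midWeight_eq_zero`).

Finally, start with `H = ∅` and, for `j = 3, 2, 1`, choose a maximal family of variable sets whose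
parts outside `H` are disjoint and have `j` elements, and add these parts to `H`
(`exists_family_and_hitting_set`). In the end `H` contains all variables, so `|V|` is at most
`3 r₃ + 2 r₂ + r₁` for the sizes `r_j` of the three families. A no-instance has
`r_j / 27 < k / 384` for each `j`, whence `|V| < 15 k`.
-/

open Finset

/-! ### Constraints and their scores -/

namespace OrdConstraint

variable {α : Type*}

/-- The set of variables of a constraint. -/
def support [DecidableEq α] (e : OrdConstraint α) : Finset α := e.tuple.toFinset

/-- The probability that a uniformly random linear ordering satisfies a given constraint. -/
def mean : OrdConstraint α → ℚ
  | two _ _ => 1 / 2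
  | three _ _ _ => 1 / 6

/-- The probability that the order on labels, with ties broken by a uniformly random linear
ordering, puts `i` before `j`, as a function of the labels `i` and `j`. -/
def score₂ (i j : ZMod 3) : ℚ :=
  if i.val < j.val then 1 else if i.val = j.val then 1 / 2 else 0

/-- The analogue of `score₂` for three variables. -/
def score₃ (i j k : ZMod 3) : ℚ :=
  if i.val < j.val then (if j.val < k.val then 1 else if j.val = k.val then 1 / 2 else 0)
  else if i.val = j.val then
    (if j.val < k.val then 1 / 2 else if j.val = k.val then 1 / 6 else 0)
  else 0

/-- The probability that a constraint is satisfied when the variables are ordered by their labels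
`y` and ties are broken by a uniformly random linear ordering. -/
def score (y : α → ZMod 3) : OrdConstraint α → ℚ
  | two u v => score₂ (y u) (y v)
  | three a b c => score₃ (y a) (y b) (y c)

/-- `b` is the middle variable of a ternary constraint. -/
def IsMid (b : α) : OrdConstraint α → Prop
  | two _ _ => False
  | three _ v _ => v = b

instance decidableIsMid [DecidableEq α] (b : α) : ∀ e : OrdConstraint α, Decidable (e.IsMid b)
  | two _ _ => inferInstanceAs (Decidable False)
  | three _ v _ => inferInstanceAs (Decidable (v = b))

theorem score_congr [DecidableEq α] {y z : α → ZMod 3} {c : OrdConstraint α}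
    (h : ∀ v ∈ c.support, y v = z v) : c.score y = c.score z := by
  cases c <;> simp_all [score, support, tuple]

end OrdConstraint

/-! ### Averaging over labelings -/

section LabelMean

variable {α : Type*} [DecidableEq α]

/-- The labeling of all of `α` that extends a labeling of `V` by zero. -/
def extendLabel (V : Finset α) (x : V → ZMod 3) (v : α) : ZMod 3 :=
  if h : v ∈ V then x ⟨v, h⟩ else 0

/-- The average of `Φ` over the labelings of `V` by elements of `ZMod 3`. -/
def labelMean (V : Finset α) (Φ : (α → ZMod 3) → ℚ) : ℚ :=
  (∑ x : V → ZMod 3, Φ (extendLabel V x)) / 3 ^ V.card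

variable {V : Finset α}

theorem labelMean_const (q : ℚ) : labelMean V (fun _ => q) = q := by
  simp [labelMean]

theorem labelMean_add (Φ Ψ : (α → ZMod 3) → ℚ) :
    labelMean V (fun y => Φ y + Ψ y) = labelMean V Φ + labelMean V Ψ := by
  simp [labelMean, sum_add_distrib, add_div]

theorem labelMean_const_mul (q : ℚ) (Φ : (α → ZMod 3) → ℚ) :
    labelMean V (fun y => q * Φ y) = q * labelMean V Φ := by
  simp [labelMean, ← mul_sum, mul_div_assoc]

theorem labelMean_sum {ι : Type*} (s : Finset ι) (Φ : ι → (α → ZMod 3) → ℚ) :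
    labelMean V (fun y => ∑ i ∈ s, Φ i y) = ∑ i ∈ s, labelMean V (Φ i) := by
  simp only [labelMean]
  rw [sum_comm, sum_div]

/-- Add `t` to the label of `v`. -/
def shiftLabel (v : α) (t : ZMod 3) (y : α → ZMod 3) : α → ZMod 3 := y + Pi.single v t

@[simp]
theorem shiftLabel_self (v : α) (t : ZMod 3) (y : α → ZMod 3) : shiftLabel v t y v = y v + t := by
  simp [shiftLabel]

theorem shiftLabel_of_ne {v w : α} (h : w ≠ v) (t : ZMod 3) (y : α → ZMod 3) :
    shiftLabel v t y w = y w := by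
  simp [shiftLabel, h]

theorem labelMean_shift {v : α} (hv : v ∈ V) (t : ZMod 3) (Φ : (α → ZMod 3) → ℚ) :
    labelMean V (fun y => Φ (shiftLabel v t y)) = labelMean V Φ := by
  unfold labelMean
  congr 1
  refine Fintype.sum_equiv (Equiv.addRight (Pi.single (⟨v, hv⟩ : V) t)) _ _ fun x => ?_
  refine congrArg Φ (funext fun w => ?_)
  by_cases hw : w ∈ V
  · by_cases h : w = v
    · subst h; simp [extendLabel, hw]
    · have : (⟨w, hw⟩ : V) ≠ ⟨v, hv⟩ := fun h' => h (by simpa using h')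
      simp [extendLabel, shiftLabel, hw, h]
  · have : w ≠ v := fun h => hw (h ▸ hv)
    simp [extendLabel, shiftLabel, hw, this]

/-- Averaging over the label of `v` first does not change the mean. -/
theorem labelMean_sum_shift {v : α} (hv : v ∈ V) (Φ : (α → ZMod 3) → ℚ) :
    labelMean V (fun y => ∑ t, Φ (shiftLabel v t y)) = 3 * labelMean V Φ := by
  rw [labelMean_sum, sum_congr rfl fun t _ => labelMean_shift hv t Φ]
  simp

theorem labelMean_mul_eq_zero {v : α} (hv : v ∈ V) {P G : (α → ZMod 3) → ℚ}
    (hP : ∀ y t, P (shiftLabel v t y) = P y) (hG : ∀ y, ∑ t, G (shiftLabel v t y) = 0) :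
    labelMean V (fun y => P y * G y) = 0 := by
  have h := labelMean_sum_shift hv fun y => P y * G y
  simp only [hP, ← mul_sum, hG, mul_zero, labelMean_const] at h
  linarith

theorem labelMean_pair {u v : α} (hu : u ∈ V) (hv : v ∈ V) (huv : u ≠ v)
    (g : ZMod 3 → ZMod 3 → ℚ) :
    labelMean V (fun y => g (y u) (y v)) = (∑ i, ∑ j, g i j) / 9 := by
  have h1 := labelMean_sum_shift hu fun y => g (y u) (y v)
  have h2 := labelMean_sum_shift hv fun y => ∑ t, g (shiftLabel u t y u) (shiftLabel u t y v)
  have h3 : ∀ y : α → ZMod 3, (∑ s, ∑ t, g (shiftLabel u t (shiftLabel v s y) u)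
      (shiftLabel u t (shiftLabel v s y) v)) = ∑ i, ∑ j, g i j := by
    intro y
    rw [sum_comm]
    refine Fintype.sum_equiv (Equiv.addLeft (y u)) _ _ fun i => ?_
    refine Fintype.sum_equiv (Equiv.addLeft (y v)) _ _ fun j => ?_
    simp [shiftLabel_of_ne huv.symm, shiftLabel_of_ne huv]
  simp only [h3, labelMean_const] at h2
  linarith

theorem labelMean_triple {a b c : α} (ha : a ∈ V) (hb : b ∈ V) (hc : c ∈ V) (hab : a ≠ b)
    (hac : a ≠ c) (hbc : b ≠ c) (g : ZMod 3 → ZMod 3 → ZMod 3 → ℚ) :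
    labelMean V (fun y => g (y a) (y b) (y c)) = (∑ i, ∑ j, ∑ k, g i j k) / 27 := by
  have h1 := labelMean_sum_shift hc fun y => g (y a) (y b) (y c)
  have h3 : ∀ y : α → ZMod 3, (∑ t, g (shiftLabel c t y a) (shiftLabel c t y b)
      (shiftLabel c t y c)) = ∑ k, g (y a) (y b) k := by
    intro y
    refine Fintype.sum_equiv (Equiv.addLeft (y c)) _ _ fun k => ?_
    simp [shiftLabel_of_ne hac, shiftLabel_of_ne hbc]
  simp only [h3] at h1
  rw [labelMean_pair ha hb hab fun i j => ∑ k, g i j k] at h1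
  linarith

/-- If `D` is a probability density on labelings, then `T` is at least its `D`-mean somewhere. -/
theorem exists_le_of_le_labelMean {D T : (α → ZMod 3) → ℚ} {q : ℚ} (hD : ∀ y, 0 ≤ D y)
    (hD1 : labelMean V D = 1) (hq : q ≤ labelMean V fun y => D y * T y) : ∃ y, q ≤ T y := by
  by_contra! h
  have h0 : labelMean V (fun y => D y * T y) ≤ labelMean V (fun y => q * D y) := by
    unfold labelMean
    gcongr with x
    nlinarith [hD (extendLabel V x), h (extendLabel V x)]
  have h1 : ∀ x, D (extendLabel V x) * (q - T (extendLabel V x)) = 0 := by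
    by_contra! hx
    obtain ⟨x, hx⟩ := hx
    have : labelMean V (fun y => D y * T y) < labelMean V (fun y => q * D y) := by
      unfold labelMean
      gcongr 1
      refine sum_lt_sum (fun x _ => ?_) ⟨x, mem_univ _, ?_⟩
      · nlinarith [hD (extendLabel V x), h (extendLabel V x)]
      · have : 0 ≤ D (extendLabel V x) * (q - T (extendLabel V x)) :=
          mul_nonneg (hD _) (by linarith [h (extendLabel V x)])
        have := lt_of_le_of_ne this hx.symm
        linarith
    rw [labelMean_const_mul, hD1] at this
    linarith
  have h2 : ∀ x, D (extendLabel V x) = 0 := fun x =>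
    (mul_eq_zero.1 (h1 x)).resolve_right (by linarith [h (extendLabel V x)])
  simp [labelMean, h2] at hD1

end LabelMean

/-! ### Tilting functions -/

section Tilt

variable {α : Type*} [DecidableEq α]

/-- A tilt of the uniform distribution on labelings by a function `G` of the labels on `e` for
which `1 + G` is nonnegative and which averages to zero over the label of each variable of `e`. -/
structure IsTilt (e : Finset α) (G : (α → ZMod 3) → ℚ) : Prop where
  neg_one_le : ∀ y, -1 ≤ G y
  shift_eq : ∀ v ∉ e, ∀ y t, G (shiftLabel v t y) = G y
  sum_shift : ∀ v ∈ e, ∀ y, ∑ t, G (shiftLabel v t y) = 0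

/-- The winner function of the game rock-paper-scissors. -/
def pairTilt (i j : ZMod 3) : ℚ := if j = i + 1 then 1 else if i = j + 1 then -1 else 0

/-- The density on three labels that makes them uniform on the solutions of `j + 1 = i + k`, minus
one. As the labels are centred at `1`, this equation favours labels with `j` between `i`
and `k`. -/
def tripleTilt (i j k : ZMod 3) : ℚ := if j + 1 = i + k then 2 else -1

theorem isTilt_pair {u v : α} (huv : u ≠ v) :
    IsTilt {u, v} fun y => pairTilt (y u) (y v) where
  neg_one_le y := by unfold pairTilt; split_ifs <;> norm_num
  shift_eq w hw y t := by
    simp only [mem_insert, mem_singleton, not_or] at hw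
    simp only [shiftLabel_of_ne (Ne.symm hw.1), shiftLabel_of_ne (Ne.symm hw.2)]
  sum_shift w hw y := by
    simp only [mem_insert, mem_singleton] at hw
    have key : ∀ i j : ZMod 3, (∑ t, pairTilt (i + t) j = 0) ∧ (∑ t, pairTilt i (j + t) = 0) := by
      decide +kernel
    rcases hw with rfl | rfl
    · simpa [shiftLabel_of_ne huv.symm] using (key (y w) (y v)).1
    · simpa [shiftLabel_of_ne huv] using (key (y u) (y w)).2

theorem isTilt_triple {a b c : α} (hab : a ≠ b) (hac : a ≠ c) (hbc : b ≠ c) :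
    IsTilt {a, b, c} fun y => tripleTilt (y a) (y b) (y c) where
  neg_one_le y := by unfold tripleTilt; split_ifs <;> norm_num
  shift_eq w hw y t := by
    simp only [mem_insert, mem_singleton, not_or] at hw
    simp only [shiftLabel_of_ne (Ne.symm hw.1), shiftLabel_of_ne (Ne.symm hw.2.1),
      shiftLabel_of_ne (Ne.symm hw.2.2)]
  sum_shift w hw y := by
    simp only [mem_insert, mem_singleton] at hw
    have key : ∀ i j k : ZMod 3, (∑ t, tripleTilt (i + t) j k = 0) ∧
        (∑ t, tripleTilt i (j + t) k = 0) ∧ (∑ t, tripleTilt i j (k + t) = 0) := by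
      decide +kernel
    rcases hw with rfl | rfl | rfl
    · simpa [shiftLabel_of_ne hab.symm, shiftLabel_of_ne hac.symm] using (key (y w) (y b) (y c)).1
    · simpa [shiftLabel_of_ne hab, shiftLabel_of_ne hbc.symm] using (key (y a) (y w) (y c)).2.1
    · simpa [shiftLabel_of_ne hac, shiftLabel_of_ne hbc] using (key (y a) (y b) (y w)).2.2

end Tilt

namespace OrdConstraint

variable {α : Type*} [DecidableEq α] {V : Finset α}

theorem labelMean_score {c : OrdConstraint α} (hV : ∀ v ∈ c.tuple, v ∈ V) (hc : c.tuple.Nodup) :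
    labelMean V (fun y => c.score y) = c.mean := by
  cases c with
  | two u v =>
    simp only [tuple, List.mem_cons, List.not_mem_nil, or_false, forall_eq_or_imp, forall_eq,
      List.nodup_cons, not_false_eq_true, List.nodup_nil, and_true] at hV hc
    simp only [score, mean]
    rw [labelMean_pair hV.1 hV.2 hc score₂]
    decide +kernel
  | three a b c =>
    simp only [tuple, List.mem_cons, List.not_mem_nil, or_false, forall_eq_or_imp, forall_eq,
      List.nodup_cons, not_false_eq_true, List.nodup_nil, and_true, not_or] at hV hc
    simp only [score, mean]
    rw [labelMean_triple hV.1 hV.2.1 hV.2.2 hc.1.1 hc.1.2 hc.2 score₃]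
    decide +kernel

theorem labelMean_pairTilt_mul {u v : α} (hu : u ∈ V) (hv : v ∈ V) (huv : u ≠ v) :
    labelMean V (fun y => pairTilt (y u) (y v) * ((two u v).score y - (two u v).mean)) = 1 / 9 := by
  simp only [score, mean]
  rw [labelMean_pair hu hv huv fun i j => pairTilt i j * (score₂ i j - 1 / 2)]
  decide +kernel

/-- The tilt at `{a, b, c}` raises the probability of each of the two constraints with `b` in the
middle by `2 / 27`, and lowers the probability of each of the other four by `1 / 27`. -/
theorem labelMean_tripleTilt_mul {a b c : α} (ha : a ∈ V) (hb : b ∈ V) (hc : c ∈ V) (hab : a ≠ b)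
    (hac : a ≠ c) (hbc : b ≠ c) {e : OrdConstraint α}
    (he : e.support = {a, b, c}) :
    labelMean V (fun y => tripleTilt (y a) (y b) (y c) * (e.score y - e.mean)) =
      if e.IsMid b then 2 / 27 else -1 / 27 := by
  have hd : ∀ p q r : α, ({p, q, r} : Finset α) = {a, b, c} → p ≠ q ∧ p ≠ r ∧ q ≠ r := by
    intro p q r h
    have h3 : ({p, q, r} : Finset α).card = 3 := by
      rw [h, card_eq_three]
      exact ⟨a, b, c, hab, hac, hbc, rfl⟩
    refine ⟨?_, ?_, ?_⟩ <;> rintro rfl <;> simp at h3 <;>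
      exact absurd h3 (ne_of_lt (card_le_two.trans_lt (by norm_num)))
  cases e with
  | two u v =>
    have h3 : ({a, b, c} : Finset α).card = 3 := card_eq_three.2 ⟨a, b, c, hab, hac, hbc, rfl⟩
    rw [← he] at h3
    have : ({u, v} : Finset α).card ≤ 2 := card_le_two
    simp [support, tuple] at h3
    omega
  | three p q r =>
    have he' : ({p, q, r} : Finset α) = {a, b, c} := by simpa [support, tuple] using he
    obtain ⟨hpq, hpr, hqr⟩ := hd p q r he'
    have hp : p = a ∨ p = b ∨ p = c := by
      have : p ∈ ({a, b, c} : Finset α) := he' ▸ (by simp)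
      simpa using this
    have hq : q = a ∨ q = b ∨ q = c := by
      have : q ∈ ({a, b, c} : Finset α) := he' ▸ (by simp)
      simpa using this
    have hr : r = a ∨ r = b ∨ r = c := by
      have : r ∈ ({a, b, c} : Finset α) := he' ▸ (by simp)
      simpa using this
    have key := labelMean_triple ha hb hc hab hac hbc
    rcases hp with rfl | rfl | rfl <;> rcases hq with rfl | rfl | rfl <;>
      rcases hr with rfl | rfl | rfl <;> first | contradiction | skip
    · rw [if_pos (by exact rfl)]
      refine (key fun i j k => tripleTilt i j k * (score₃ i j k - 1 / 6)).trans ?_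
      decide +kernel
    · rw [if_neg (by exact hbc.symm)]
      refine (key fun i j k => tripleTilt i j k * (score₃ i k j - 1 / 6)).trans ?_
      decide +kernel
    · rw [if_neg (by exact hab)]
      refine (key fun i j k => tripleTilt i j k * (score₃ j i k - 1 / 6)).trans ?_
      decide +kernel
    · rw [if_neg (by exact hbc.symm)]
      refine (key fun i j k => tripleTilt i j k * (score₃ j k i - 1 / 6)).trans ?_
      decide +kernel
    · rw [if_neg (by exact hab)]
      refine (key fun i j k => tripleTilt i j k * (score₃ k i j - 1 / 6)).trans ?_
      decide +kernel
    · rw [if_pos (by exact rfl)]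
      refine (key fun i j k => tripleTilt i j k * (score₃ k j i - 1 / 6)).trans ?_
      decide +kernel

end OrdConstraint

/-! ### Uniformly random orderings -/

namespace LinOrd3

open OrdConstraint

variable {α : Type*} [DecidableEq α] (I : LinOrd3 α)

theorem pos_le (φ : I.Ordering) (v : α) : I.pos φ v ≤ I.vars.card := by
  unfold pos
  split_ifs with h
  · exact (φ ⟨v, h⟩).isLt
  · exact Nat.zero_le _

theorem pos_injOn (φ : I.Ordering) : Set.InjOn (I.pos φ) I.vars := by
  intro u hu v hv h
  simp only [pos, mem_coe.1 hu, mem_coe.1 hv, dif_pos] at h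
  simpa using φ.injective (Fin.ext (Nat.succ.inj h))

theorem pos_swap {u v : α} (hu : u ∈ I.vars) (hv : v ∈ I.vars) (φ : I.Ordering) (w : α) :
    I.pos ((Equiv.swap (⟨u, hu⟩ : {x // x ∈ I.vars}) ⟨v, hv⟩).trans φ) w =
      I.pos φ (Equiv.swap u v w) := by
  unfold pos
  by_cases hw : w ∈ I.vars
  · have : Equiv.swap u v w ∈ I.vars := by
      rw [Equiv.swap_apply_def]; split_ifs <;> assumption
    simp only [hw, this, dif_pos, Equiv.trans_apply]
    congr 3
    apply Subtype.ext
    simp only [Equiv.swap_apply_def, Subtype.mk.injEq]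
    split_ifs <;> rfl
  · have h1 : w ≠ u := fun h => hw (h ▸ hu)
    have h2 : w ≠ v := fun h => hw (h ▸ hv)
    simp [Equiv.swap_apply_of_ne_of_ne h1 h2, hw]

/-- Exchanging two variables preserves the uniform distribution on orderings. -/
theorem sum_swap {u v : α} (hu : u ∈ I.vars) (hv : v ∈ I.vars) (f : (α → ℕ) → ℚ) :
    ∑ φ : I.Ordering, f (fun w => I.pos φ (Equiv.swap u v w)) = ∑ φ : I.Ordering, f (I.pos φ) := by
  refine Fintype.sum_equiv (Equiv.equivCongr (Equiv.swap (⟨u, hu⟩ : {x // x ∈ I.vars}) ⟨v, hv⟩)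
    (Equiv.refl _)) _ _ fun φ => ?_
  congr 1
  funext w
  rw [← I.pos_swap hu hv]
  rfl

theorem sum_two {u v : α} (hu : u ∈ I.vars) (hv : v ∈ I.vars) (huv : u ≠ v) :
    ∑ φ : I.Ordering, (if I.pos φ u < I.pos φ v then (1 : ℚ) else 0) =
      Fintype.card I.Ordering / 2 := by
  have h1 := I.sum_swap hu hv fun p => if p u < p v then (1 : ℚ) else 0
  simp only [Equiv.swap_apply_left, Equiv.swap_apply_right] at h1
  have h2 : ∑ φ : I.Ordering, ((if I.pos φ u < I.pos φ v then (1 : ℚ) else 0) +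
      (if I.pos φ v < I.pos φ u then (1 : ℚ) else 0)) = Fintype.card I.Ordering := by
    rw [sum_congr rfl (g := fun _ => (1 : ℚ))]
    · simp
    · intro φ _
      have := (I.pos_injOn φ).ne hu hv huv
      split_ifs <;> first | omega | norm_num
  rw [sum_add_distrib, h1] at h2
  linarith

theorem sum_three {a b c : α} (ha : a ∈ I.vars) (hb : b ∈ I.vars) (hc : c ∈ I.vars) (hab : a ≠ b)
    (hac : a ≠ c) (hbc : b ≠ c) :
    ∑ φ : I.Ordering, (if I.pos φ a < I.pos φ b ∧ I.pos φ b < I.pos φ c then (1 : ℚ) else 0) =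
      Fintype.card I.Ordering / 6 := by
  have key : ∀ x y z : α, ∀ (hx : x ∈ I.vars) (hy : y ∈ I.vars) (hxz : x ≠ z) (hyz : y ≠ z),
      ∑ φ : I.Ordering, (if I.pos φ y < I.pos φ x ∧ I.pos φ x < I.pos φ z then (1 : ℚ) else 0) =
      ∑ φ : I.Ordering, (if I.pos φ x < I.pos φ y ∧ I.pos φ y < I.pos φ z then (1 : ℚ) else 0) := by
    intro x y z hx hy hxz hyz
    have h := I.sum_swap hx hy fun p => if p x < p y ∧ p y < p z then (1 : ℚ) else 0
    simpa only [Equiv.swap_apply_left, Equiv.swap_apply_right,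
      Equiv.swap_apply_of_ne_of_ne hxz.symm hyz.symm] using h
  have key' : ∀ x y z : α, ∀ (hy : y ∈ I.vars) (hz : z ∈ I.vars) (hxy : x ≠ y) (hxz : x ≠ z),
      ∑ φ : I.Ordering, (if I.pos φ x < I.pos φ z ∧ I.pos φ z < I.pos φ y then (1 : ℚ) else 0) =
      ∑ φ : I.Ordering, (if I.pos φ x < I.pos φ y ∧ I.pos φ y < I.pos φ z then (1 : ℚ) else 0) := by
    intro x y z hy hz hxy hxz
    have h := I.sum_swap hy hz fun p => if p x < p y ∧ p y < p z then (1 : ℚ) else 0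
    simpa only [Equiv.swap_apply_left, Equiv.swap_apply_right,
      Equiv.swap_apply_of_ne_of_ne hxy hxz] using h
  have h1 := key a b c ha hb hac hbc
  have h2 := key' b a c ha hc hab.symm hbc
  have h3 := key b c a hb hc hab.symm hac.symm
  have h4 := key' c b a hb ha hbc.symm hac.symm
  have h5 := key c a b hc ha hbc.symm hab
  have h6 : ∑ φ : I.Ordering,
      ((if I.pos φ a < I.pos φ b ∧ I.pos φ b < I.pos φ c then (1 : ℚ) else 0) +
      (if I.pos φ b < I.pos φ a ∧ I.pos φ a < I.pos φ c then (1 : ℚ) else 0) +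
      (if I.pos φ b < I.pos φ c ∧ I.pos φ c < I.pos φ a then (1 : ℚ) else 0) +
      (if I.pos φ c < I.pos φ b ∧ I.pos φ b < I.pos φ a then (1 : ℚ) else 0) +
      (if I.pos φ c < I.pos φ a ∧ I.pos φ a < I.pos φ b then (1 : ℚ) else 0) +
      (if I.pos φ a < I.pos φ c ∧ I.pos φ c < I.pos φ b then (1 : ℚ) else 0)) =
      Fintype.card I.Ordering := by
    rw [sum_congr rfl (g := fun _ => (1 : ℚ))]
    · simp
    · intro φ _
      have n1 := (I.pos_injOn φ).ne ha hb hab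
      have n2 := (I.pos_injOn φ).ne ha hc hac
      have n3 := (I.pos_injOn φ).ne hb hc hbc
      rcases lt_or_gt_of_ne n1 with g1 | g1 <;> rcases lt_or_gt_of_ne n2 with g2 | g2 <;>
        rcases lt_or_gt_of_ne n3 with g3 | g3 <;>
        first | omega | simp [g1, g2, g3, g1.not_gt, g2.not_gt, g3.not_gt]
  simp only [sum_add_distrib] at h6
  linarith

/-- Positions that compare labels first and then positions in `φ`. -/
def labelPos (y : α → ZMod 3) (φ : I.Ordering) (v : α) : ℕ :=
  (y v).val * (I.vars.card + 1) + I.pos φ v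

theorem labelPos_lt_iff (y : α → ZMod 3) (φ : I.Ordering) (u v : α) :
    I.labelPos y φ u < I.labelPos y φ v ↔
      (y u).val < (y v).val ∨ (y u).val = (y v).val ∧ I.pos φ u < I.pos φ v := by
  have h1 := I.pos_le φ u
  have h2 := I.pos_le φ v
  unfold labelPos
  rcases lt_trichotomy (y u).val (y v).val with h | h | h
  · have : ((y u).val + 1) * (I.vars.card + 1) ≤ (y v).val * (I.vars.card + 1) := by gcongr; omega
    simp only [h, true_or, iff_true]
    linarith
  · simp [h]
  · have : ((y v).val + 1) * (I.vars.card + 1) ≤ (y u).val * (I.vars.card + 1) := by gcongr; omega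
    simp only [h.not_gt, h.ne', false_and, or_self, iff_false, not_lt]
    linarith

theorem labelPos_injOn (y : α → ZMod 3) (φ : I.Ordering) : Set.InjOn (I.labelPos y φ) I.vars := by
  intro u hu v hv h
  have h1 := (I.labelPos_lt_iff y φ u v).not.1 h.not_lt
  have h2 := (I.labelPos_lt_iff y φ v u).not.1 h.not_gt
  exact I.pos_injOn φ hu hv (by omega)

/-- For fixed labels, `score` is the probability that a constraint is satisfied after breaking
ties by a uniformly random ordering. -/
theorem sum_sat_labelPos (y : α → ZMod 3) {c : OrdConstraint α} (hV : ∀ v ∈ c.tuple, v ∈ I.vars)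
    (hc : c.tuple.Nodup) :
    ∑ φ : I.Ordering, (if c.Sat (I.labelPos y φ) then (1 : ℚ) else 0) =
      c.score y * Fintype.card I.Ordering := by
  cases c with
  | two u v =>
    simp only [tuple, List.mem_cons, List.not_mem_nil, or_false, forall_eq_or_imp, forall_eq,
      List.nodup_cons, not_false_eq_true, List.nodup_nil, and_true] at hV hc
    have h := I.sum_two hV.1 hV.2 hc
    simp only [Sat, labelPos_lt_iff, score, score₂]
    rcases lt_trichotomy (y u).val (y v).val with h1 | h1 | h1
    · simp [h1]
    · simp [h1, h]; ring
    · simp [h1.not_gt, h1.ne']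
  | three a b c =>
    simp only [tuple, List.mem_cons, List.not_mem_nil, or_false, forall_eq_or_imp, forall_eq,
      List.nodup_cons, not_false_eq_true, List.nodup_nil, and_true, not_or] at hV hc
    have h3 := I.sum_three hV.1 hV.2.1 hV.2.2 hc.1.1 hc.1.2 hc.2
    have h12 := I.sum_two hV.1 hV.2.1 hc.1.1
    have h23 := I.sum_two hV.2.1 hV.2.2 hc.2
    simp only [Sat, labelPos_lt_iff, score, score₃]
    -- as equations between propositions, these facts do not rewrite one label into another
    have tri : ∀ i j : ℕ, (i < j) = True ∧ (i = j) = False ∨ (i < j) = False ∧ (i = j) = True ∨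
        (i < j) = False ∧ (i = j) = False := by
      intro i j
      rcases lt_trichotomy i j with h | h | h
      · simp [h, h.ne]
      · simp [h]
      · simp [h.not_gt, h.ne']
    rcases tri (y a).val (y b).val with ⟨h1, e1⟩ | ⟨h1, e1⟩ | ⟨h1, e1⟩ <;>
      rcases tri (y b).val (y c).val with ⟨h2, e2⟩ | ⟨h2, e2⟩ | ⟨h2, e2⟩ <;>
      simp only [h1, h2, e1, e2, true_and, false_and, and_false, or_false, false_or, if_true,
        if_false, and_true, h3, h12, h23, sum_const_zero, sum_const, card_univ, nsmul_eq_mul] <;>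
      ring

/-- Injective positions in `ℕ` can be compressed to a linear ordering. -/
theorem exists_ordering_sat_iff {p : α → ℕ} (hp : Set.InjOn p I.vars) :
    ∃ φ : I.Ordering, ∀ c : OrdConstraint α, (∀ v ∈ c.tuple, v ∈ I.vars) →
      (c.Sat (I.pos φ) ↔ c.Sat p) := by
  have hcard : (I.vars.image p).card = I.vars.card := card_image_of_injOn hp
  let ψ := ((I.vars.image p).orderIsoOfFin hcard).symm
  let e : {x // x ∈ I.vars} → {m // m ∈ I.vars.image p} := fun x =>
    ⟨p x, mem_image_of_mem p x.2⟩
  have he : Function.Bijective e := by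
    refine ⟨fun x y h => Subtype.ext (hp x.2 y.2 (congrArg Subtype.val h)), fun m => ?_⟩
    obtain ⟨x, hx, hm⟩ := mem_image.1 m.2
    exact ⟨⟨x, hx⟩, Subtype.ext hm⟩
  let φ : I.Ordering := (Equiv.ofBijective e he).trans ψ.toEquiv
  have key : ∀ u ∈ I.vars, ∀ v ∈ I.vars, (I.pos φ u < I.pos φ v ↔ p u < p v) := by
    intro u hu v hv
    simp only [pos, hu, hv, dif_pos, add_lt_add_iff_right, Fin.val_fin_lt]
    exact ψ.lt_iff_lt
  refine ⟨φ, fun c hc => ?_⟩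
  cases c with
  | two u v =>
    simp only [tuple, List.mem_cons, List.not_mem_nil, or_false, forall_eq_or_imp, forall_eq] at hc
    exact key u hc.1 v hc.2
  | three a b c =>
    simp only [tuple, List.mem_cons, List.not_mem_nil, or_false, forall_eq_or_imp, forall_eq] at hc
    exact and_congr (key a hc.1 b hc.2.1) (key b hc.2.1 c hc.2.2)

variable {I} {S : Finset (OrdConstraint α × ℕ)}

theorem weight_eq_sum (hS : S.val = I.constraints) (φ : I.Ordering) :
    (I.weight φ : ℚ) = ∑ c ∈ S, (c.2 : ℚ) * if c.1.Sat (I.pos φ) then 1 else 0 := by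
  have : I.weight φ = ∑ c ∈ S, if c.1.Sat (I.pos φ) then c.2 else 0 := by
    rw [weight, ← hS]; rfl
  simp [this]

theorem card_ordering_pos : (0 : ℚ) < Fintype.card I.Ordering := by
  have : Nonempty I.Ordering := ⟨I.vars.equivFin⟩
  exact_mod_cast Fintype.card_pos

theorem rho_mul_totalWeight (hS : S.val = I.constraints) :
    I.rho * I.totalWeight = ∑ c ∈ S, (c.2 : ℚ) * c.1.mean := by
  have hN := card_ordering_pos (I := I)
  have hmem : ∀ c ∈ S, c ∈ I.constraints := fun c hc => hS ▸ hc
  have h1 : ∑ φ : I.Ordering, (I.weight φ : ℚ) =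
      (∑ c ∈ S, (c.2 : ℚ) * c.1.mean) * Fintype.card I.Ordering := by
    simp only [weight_eq_sum hS]
    rw [sum_comm, sum_mul]
    refine sum_congr rfl fun c hc => ?_
    have hV := I.mem_vars c (hmem c hc)
    have hd := I.nodup c (hmem c hc)
    -- all labels equal: the labels play no role
    have h0 := I.sum_sat_labelPos 0 hV hd
    have h2 : c.1.score (0 : α → ZMod 3) = c.1.mean := by
      cases c.1 <;> simp [score, score₂, score₃, mean]
    have h3 : I.labelPos (0 : α → ZMod 3) = I.pos := by
      funext φ v; simp [labelPos]
    rw [← mul_sum, mul_assoc, ← h2, ← h0, h3]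
  have hW : I.totalWeight = ∑ c ∈ S, c.2 := by
    rw [totalWeight, ← hS]; rfl
  rw [rho, ← sum_div, h1]
  by_cases h : I.totalWeight = 0
  · have : ∀ c ∈ S, c.2 = 0 := by
      rw [hW] at h
      simpa using h
    rw [h, sum_congr rfl fun c hc => by rw [this c hc]]
    simp
  · have : (I.totalWeight : ℚ) ≠ 0 := by exact_mod_cast h
    field_simp

/-- Some way of breaking the ties of a labeling is at least as good as a random one. -/
theorem exists_ordering_of_label (hS : S.val = I.constraints) (y : α → ZMod 3) :
    ∃ φ : I.Ordering, I.rho * I.totalWeight + ∑ c ∈ S, (c.2 : ℚ) * (c.1.score y - c.1.mean) ≤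
      I.weight φ := by
  have hN := card_ordering_pos (I := I)
  have hmem : ∀ c ∈ S, c ∈ I.constraints := fun c hc => hS ▸ hc
  have h1 : ∑ φ : I.Ordering, ∑ c ∈ S, (c.2 : ℚ) * (if c.1.Sat (I.labelPos y φ) then 1 else 0) =
      ∑ _φ : I.Ordering, ∑ c ∈ S, (c.2 : ℚ) * c.1.score y := by
    rw [sum_comm, sum_const, card_univ, nsmul_eq_mul, mul_sum]
    refine sum_congr rfl fun c hc => ?_
    rw [← mul_sum, I.sum_sat_labelPos y (I.mem_vars c (hmem c hc)) (I.nodup c (hmem c hc))]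
    ring
  obtain ⟨φ, -, hφ⟩ := exists_le_of_sum_le (univ_nonempty_iff.2 ⟨I.vars.equivFin⟩) h1.ge
  obtain ⟨ψ, hψ⟩ := I.exists_ordering_sat_iff (I.labelPos_injOn y φ)
  refine ⟨ψ, ?_⟩
  rw [rho_mul_totalWeight hS, weight_eq_sum hS, ← sum_add_distrib]
  refine le_trans (le_of_eq (sum_congr rfl fun c _ => by ring)) (hφ.trans (le_of_eq ?_))
  exact sum_congr rfl fun c hc => by simp only [hψ c.1 (I.mem_vars c (hmem c hc))]

end LinOrd3

/-! ### The gain of a family of tilts -/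

section Product

variable {α : Type*} [DecidableEq α] {V H : Finset α} {F : Finset (Finset α)}
  {G : Finset α → (α → ZMod 3) → ℚ}

theorem labelMean_prod_mul_eq_zero {J : Finset (Finset α)} {P : (α → ZMod 3) → ℚ}
    (hG : ∀ e ∈ J, IsTilt e (G e)) {e : Finset α} (he : e ∈ J) {v : α} (hV : v ∈ V) (hv : v ∈ e)
    (hJ : ∀ e' ∈ J, e' ≠ e → v ∉ e') (hP : ∀ y t, P (shiftLabel v t y) = P y) :
    labelMean V (fun y => (∏ e ∈ J, G e y) * P y) = 0 := by
  have h := labelMean_mul_eq_zero hV (P := fun y => P y * ∏ e' ∈ J.erase e, G e' y) (G := G e)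
    (fun y t => ?_) ((hG e he).sum_shift v hv)
  · rw [← h]
    congr 1
    funext y
    rw [← mul_prod_erase J (fun e => G e y) he]
    ring
  · rw [hP, prod_congr rfl fun e' he' => (hG e' (mem_of_mem_erase he')).shift_eq v
      (hJ e' (mem_of_mem_erase he') (ne_of_mem_erase he')) y t]

theorem labelMean_prod_tilt (hG : ∀ e ∈ F, IsTilt e (G e)) (hV : ∀ e ∈ F, e ⊆ V)
    (hne : ∀ e ∈ F, (e \ H).Nonempty) (hdis : (F : Set (Finset α)).PairwiseDisjoint (· \ H)) :
    labelMean V (fun y => ∏ e ∈ F, (1 + G e y)) = 1 := by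
  simp only [prod_one_add]
  rw [labelMean_sum, sum_eq_single_of_mem ∅ (empty_mem_powerset F)]
  · simpa using labelMean_const 1
  · intro J hJ hJ0
    rw [mem_powerset] at hJ
    obtain ⟨e, he⟩ := nonempty_iff_ne_empty.2 hJ0
    obtain ⟨v, hv⟩ := hne e (hJ he)
    have := labelMean_prod_mul_eq_zero (V := V) (P := fun _ => 1) (fun e he => hG e (hJ he)) he
      (hV e (hJ he) (mem_sdiff.1 hv).1) (mem_sdiff.1 hv).1
      (fun e' he' hne' hv' => disjoint_left.1 (hdis (hJ he') (hJ he) hne')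
        (mem_sdiff.2 ⟨hv', (mem_sdiff.1 hv).2⟩) hv) (fun _ _ => rfl)
    simpa using this

/-- In the expansion of the product density against a centred function of the labels on `s`, only
the linear term of the tilt at `s` itself survives: in every other term, some label occurs in
exactly one factor, and that factor averages to zero over it. -/
theorem labelMean_prod_tilt_mul {s : Finset α} {P : (α → ZMod 3) → ℚ}
    (hP : ∀ v ∉ s, ∀ y t, P (shiftLabel v t y) = P y) (hP0 : labelMean V P = 0)
    (hG : ∀ e ∈ F, IsTilt e (G e)) (hV : ∀ e ∈ F, e ⊆ V)
    (hne : ∀ e ∈ F, (e \ H).Nonempty) (hdis : (F : Set (Finset α)).PairwiseDisjoint (· \ H))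
    (hcard : ∀ e ∈ F, (s \ H).card ≤ (e \ H).card) (hmax : ∀ e ∈ F, e ⊆ s → s = e) :
    labelMean V (fun y => (∏ e ∈ F, (1 + G e y)) * P y) =
      ∑ e ∈ F, if s = e then labelMean V (fun y => G e y * P y) else 0 := by
  have key : ∀ J ∈ F.powerset, J ≠ {s} → labelMean V (fun y => (∏ e ∈ J, G e y) * P y) = 0 := by
    intro J hJ hJs
    rw [mem_powerset] at hJ
    have hGJ : ∀ e ∈ J, IsTilt e (G e) := fun e he => hG e (hJ he)
    rcases J.eq_empty_or_nonempty with rfl | ⟨e, he⟩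
    · simpa using hP0
    by_cases hex : ∃ e ∈ J, ¬ e \ H ⊆ s
    · obtain ⟨e, he, hs⟩ := hex
      obtain ⟨v, hv, hvs⟩ := not_subset.1 hs
      exact labelMean_prod_mul_eq_zero hGJ he (hV e (hJ he) (mem_sdiff.1 hv).1) (mem_sdiff.1 hv).1
        (fun e' he' hne' hv' => disjoint_left.1 (hdis (hJ he') (hJ he) hne')
          (mem_sdiff.2 ⟨hv', (mem_sdiff.1 hv).2⟩) hv) (hP v hvs)
    · push Not at hex
      have heq : ∀ e ∈ J, e \ H = s \ H := fun e he =>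
        eq_of_subset_of_card_le
          (fun v hv => mem_sdiff.2 ⟨hex e he hv, (mem_sdiff.1 hv).2⟩) (hcard e (hJ he))
      have hJe : ∀ e' ∈ J, e' = e := by
        intro e' he'
        by_contra hne'
        have hd : Disjoint (e' \ H) (e \ H) := hdis (hJ he') (hJ he) hne'
        rw [heq e' he', heq e he, disjoint_self_iff_empty, ← heq e he] at hd
        exact (hne e (hJ he)).ne_empty hd
      have hes : ¬ e ⊆ s := fun h => hJs <| by
        rw [hmax e (hJ he) h]
        exact eq_singleton_iff_unique_mem.2 ⟨he, hJe⟩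
      obtain ⟨v, hv, hvs⟩ := not_subset.1 hes
      exact labelMean_prod_mul_eq_zero hGJ he (hV e (hJ he) hv) hv
        (fun e' he' hne' => absurd (hJe e' he') hne') (hP v hvs)
  simp only [prod_one_add, sum_mul]
  rw [labelMean_sum, sum_ite_eq]
  split_ifs with hs
  · rw [sum_eq_single_of_mem {s} (mem_powerset.2 (singleton_subset_iff.2 hs)) key]
    simp
  · refine sum_eq_zero fun J hJ => key J hJ ?_
    rintro rfl
    exact hs (singleton_subset_iff.1 (mem_powerset.1 hJ))

end Product

namespace LinOrd3

open OrdConstraint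

variable {α : Type*} [DecidableEq α] {I : LinOrd3 α} {S : Finset (OrdConstraint α × ℕ)}

theorem support_subset (hS : S.val = I.constraints) {c : OrdConstraint α × ℕ} (hc : c ∈ S) :
    c.1.support ⊆ I.vars := fun v hv =>
  I.mem_vars c (hS ▸ hc) v (by simpa [support] using hv)

/-- The expected weight gained on the constraints with variable set `e` by the tilt `G`. -/
def tiltGain (V : Finset α) (S : Finset (OrdConstraint α × ℕ)) (e : Finset α)
    (G : (α → ZMod 3) → ℚ) : ℚ :=
  ∑ c ∈ S with c.1.support = e, (c.2 : ℚ) * labelMean V fun y => G y * (c.1.score y - c.1.mean)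

/-- The gains of tilts at variable sets whose parts outside `H` are disjoint and as large as
possible add up. -/
theorem exists_ordering_of_tilts (hS : S.val = I.constraints) {H : Finset α}
    {F : Finset (Finset α)} {G : Finset α → (α → ZMod 3) → ℚ} {q : ℚ}
    (hG : ∀ e ∈ F, IsTilt e (G e)) (hV : ∀ e ∈ F, e ⊆ I.vars)
    (hne : ∀ e ∈ F, (e \ H).Nonempty) (hdis : (F : Set (Finset α)).PairwiseDisjoint (· \ H))
    (hcard : ∀ c ∈ S, ∀ e ∈ F, (c.1.support \ H).card ≤ (e \ H).card)
    (hmax : ∀ c ∈ S, ∀ e ∈ F, e ⊆ c.1.support → c.1.support = e)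
    (hgain : ∀ e ∈ F, q ≤ tiltGain I.vars S e (G e)) :
    ∃ φ : I.Ordering, I.rho * I.totalWeight + F.card * q ≤ I.weight φ := by
  have hmean : ∀ c ∈ S, labelMean I.vars (fun y => c.1.score y - c.1.mean) = 0 := by
    intro c hc
    simp only [sub_eq_add_neg]
    rw [labelMean_add, labelMean_const, labelMean_score (I.mem_vars c (hS ▸ hc))
      (I.nodup c (hS ▸ hc)), add_neg_cancel]
  have hshift : ∀ c ∈ S, ∀ v ∉ c.1.support, ∀ y t,
      c.1.score (shiftLabel v t y) - c.1.mean = c.1.score y - c.1.mean := by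
    intro c _ v hv y t
    rw [score_congr fun w hw => shiftLabel_of_ne (by rintro rfl; exact hv hw) t y]
  have hq : F.card * q ≤ labelMean I.vars fun y =>
      (∏ e ∈ F, (1 + G e y)) * ∑ c ∈ S, (c.2 : ℚ) * (c.1.score y - c.1.mean) := by
    have h1 : (labelMean I.vars fun y =>
        (∏ e ∈ F, (1 + G e y)) * ∑ c ∈ S, (c.2 : ℚ) * (c.1.score y - c.1.mean)) =
        ∑ e ∈ F, tiltGain I.vars S e (G e) := by
      simp only [mul_sum, mul_left_comm _ (Nat.cast _ : ℚ)]
      rw [labelMean_sum]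
      simp only [labelMean_const_mul]
      rw [sum_congr rfl fun c hc => by
        rw [labelMean_prod_tilt_mul (hshift c hc) (hmean c hc) hG hV hne hdis (hcard c hc)
          (hmax c hc), mul_sum]]
      rw [sum_comm]
      refine sum_congr rfl fun e _ => ?_
      rw [tiltGain, sum_filter]
      exact sum_congr rfl fun c _ => by rw [mul_ite, mul_zero]
    rw [h1, ← nsmul_eq_mul]
    exact card_nsmul_le_sum F _ q hgain
  obtain ⟨y, hy⟩ := exists_le_of_le_labelMean
    (fun y => prod_nonneg fun e he => by linarith [(hG e he).neg_one_le y])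
    (labelMean_prod_tilt hG hV hne hdis) hq
  obtain ⟨φ, hφ⟩ := exists_ordering_of_label hS y
  exact ⟨φ, by linarith⟩

/-! ### Irreducible instances -/

section Constraints

variable {α : Type*} {I : LinOrd3 α}

theorem exists_with_constraints (I : LinOrd3 α) (C : Multiset (OrdConstraint α × ℕ))
    (hC : ∀ c ∈ C, (∀ x ∈ c.1.tuple, x ∈ I.vars) ∧ c.1.tuple.Nodup) :
    ∃ J : LinOrd3 α, J.vars = I.vars ∧ J.constraints = C ∧ J.k = I.k :=
  ⟨⟨I.vars, C, I.k, fun c hc => (hC c hc).1, fun c hc => (hC c hc).2⟩, rfl, rfl, rfl⟩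

theorem exists_eq_cons_cons {β : Type*} {s : Multiset β} {x y : β} (hx : x ∈ s) (hy : y ∈ s)
    (hxy : x ≠ y) : ∃ t, s = x ::ₘ y ::ₘ t := by
  obtain ⟨t, rfl⟩ := Multiset.exists_cons_of_mem hx
  obtain ⟨u, rfl⟩ := Multiset.exists_cons_of_mem
    ((Multiset.mem_cons.1 hy).resolve_left hxy.symm)
  exact ⟨u, rfl⟩

theorem exists_eq_cons_cons_cons {β : Type*} {s : Multiset β} {x y z : β} (hx : x ∈ s)
    (hy : y ∈ s) (hz : z ∈ s) (hxy : x ≠ y) (hxz : x ≠ z) (hyz : y ≠ z) :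
    ∃ t, s = x ::ₘ y ::ₘ z ::ₘ t := by
  obtain ⟨t, rfl⟩ := exists_eq_cons_cons hx hy hxy
  simp only [Multiset.mem_cons] at hz
  obtain ⟨u, rfl⟩ := Multiset.exists_cons_of_mem
    ((hz.resolve_left hxz.symm).resolve_left hyz.symm)
  exact ⟨u, rfl⟩

/-- The tuples of an instance remain valid under any change of weights. -/
theorem valid_of_mem {c : OrdConstraint α × ℕ} (hc : c ∈ I.constraints) (w : ℕ) :
    (∀ x ∈ ((c.1, w) : OrdConstraint α × ℕ).1.tuple, x ∈ I.vars) ∧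
      ((c.1, w) : OrdConstraint α × ℕ).1.tuple.Nodup :=
  ⟨I.mem_vars c hc, I.nodup c hc⟩

end Constraints

theorem Irreducible.nodup_constraints (h : I.Irreducible) : I.constraints.Nodup := by
  rw [Multiset.nodup_iff_ne_cons_cons]
  rintro ⟨e, w⟩ C hC
  obtain ⟨J, hV, hJ, hk⟩ := I.exists_with_constraints ((e, w + w) ::ₘ C) (by
    intro c hc
    rcases Multiset.mem_cons.1 hc with rfl | hc
    · exact valid_of_mem (c := (e, w)) (by simp [hC]) _
    · exact valid_of_mem (c := c) (by simp [hC, hc]) _)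
  exact (h J).2.1 ⟨e, w, w, C, hC, hV, hJ, hk⟩

theorem Irreducible.weight_pos (h : I.Irreducible) {e : OrdConstraint α} {w : ℕ}
    (hc : (e, w) ∈ I.constraints) : 0 < w := by
  rw [Nat.pos_iff_ne_zero]
  rintro rfl
  obtain ⟨C, hC⟩ := Multiset.exists_cons_of_mem hc
  obtain ⟨J, hV, hJ, hk⟩ := I.exists_with_constraints C (by
    intro c hc
    exact valid_of_mem (c := c) (by simp [hC, hc]) _)
  exact (h J).1 (.removeConstraint e C hC hV hJ hk)

theorem Irreducible.exists_mem_tuple (h : I.Irreducible) {v : α} (hv : v ∈ I.vars) :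
    ∃ c ∈ I.constraints, v ∈ c.1.tuple := by
  by_contra! hfree
  let J : LinOrd3 α := ⟨I.vars.erase v, I.constraints, I.k,
    fun c hc x hx => mem_erase.2 ⟨fun hxv => hfree c hc (hxv ▸ hx), I.mem_vars c hc x hx⟩, I.nodup⟩
  exact (h J).1 (.removeVar v hv hfree rfl rfl rfl)

theorem Irreducible.not_opposite (h : I.Irreducible) {u v : α} {w₁ w₂ : ℕ}
    (h₁ : (two u v, w₁) ∈ I.constraints) (h₂ : (two v u, w₂) ∈ I.constraints) : False := by
  have huv : u ≠ v := by simpa [tuple] using I.nodup _ h₁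
  obtain ⟨C, hC⟩ := exists_eq_cons_cons h₁ h₂ (by simp [huv])
  obtain ⟨J, hV, hJ, hk⟩ := I.exists_with_constraints
    ((two u v, w₁ - min w₁ w₂) ::ₘ (two v u, w₂ - min w₁ w₂) ::ₘ C) (by
    intro c hc
    simp only [Multiset.mem_cons] at hc
    rcases hc with rfl | rfl | hc
    · exact valid_of_mem h₁ _
    · exact valid_of_mem h₂ _
    · exact valid_of_mem (c := c) (by simp [hC, hc]) _)
  exact (h J).2.2.1 ⟨u, v, w₁, w₂, _, rfl, C, hC, hV, hJ, hk⟩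

theorem Irreducible.not_edge (h : I.Irreducible) {a b c : α} {w₁ w₂ w₃ : ℕ}
    (h₁ : (three a b c, w₁) ∈ I.constraints) (h₂ : (three b a c, w₂) ∈ I.constraints)
    (h₃ : (three a c b, w₃) ∈ I.constraints) : False := by
  have hd : (a ≠ b ∧ a ≠ c) ∧ b ≠ c := by simpa [tuple] using I.nodup _ h₁
  have hv : a ∈ I.vars ∧ b ∈ I.vars ∧ c ∈ I.vars := by simpa [tuple] using I.mem_vars _ h₁
  obtain ⟨C, hC⟩ := exists_eq_cons_cons_cons h₁ h₂ h₃ (by simp [hd.1.1]) (by simp [hd.2])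
    (by simp [hd.1.1.symm])
  obtain ⟨J, hV, hJ, hk⟩ := I.exists_with_constraints
    ((three a b c, w₁ - min w₁ (min w₂ w₃)) ::ₘ (three b a c, w₂ - min w₁ (min w₂ w₃)) ::ₘ
      (three a c b, w₃ - min w₁ (min w₂ w₃)) ::ₘ (two a c, min w₁ (min w₂ w₃)) ::ₘ C) (by
    intro x hx
    simp only [Multiset.mem_cons] at hx
    rcases hx with rfl | rfl | rfl | rfl | hx
    · exact valid_of_mem h₁ _
    · exact valid_of_mem h₂ _
    · exact valid_of_mem h₃ _
    · simp [tuple, hv, hd]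
    · exact valid_of_mem (c := x) (by simp [hC, hx]) _)
  exact (h J).2.2.2.1 ⟨a, b, c, w₁, w₂, w₃, _, rfl, C, hC, hV, hJ, hk⟩

theorem Irreducible.not_cycle (h : I.Irreducible) {a b c : α} {w₁ w₂ w₃ : ℕ}
    (h₁ : (three a b c, w₁) ∈ I.constraints) (h₂ : (three b c a, w₂) ∈ I.constraints)
    (h₃ : (three c a b, w₃) ∈ I.constraints) : False := by
  have hd : (a ≠ b ∧ a ≠ c) ∧ b ≠ c := by simpa [tuple] using I.nodup _ h₁
  have hv : a ∈ I.vars ∧ b ∈ I.vars ∧ c ∈ I.vars := by simpa [tuple] using I.mem_vars _ h₁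
  obtain ⟨C, hC⟩ := exists_eq_cons_cons_cons h₁ h₂ h₃ (by simp [hd.1.1]) (by simp [hd.1.2])
    (by simp [hd.2])
  obtain ⟨J, hV, hJ, hk⟩ := I.exists_with_constraints
    ((three a b c, w₁ - min w₁ (min w₂ w₃)) ::ₘ (three b c a, w₂ - min w₁ (min w₂ w₃)) ::ₘ
      (three c a b, w₃ - min w₁ (min w₂ w₃)) ::ₘ (two a b, min w₁ (min w₂ w₃)) ::ₘ
      (two b c, min w₁ (min w₂ w₃)) ::ₘ (two c a, min w₁ (min w₂ w₃)) ::ₘ C) (by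
    intro x hx
    simp only [Multiset.mem_cons] at hx
    rcases hx with rfl | rfl | rfl | rfl | rfl | rfl | hx
    · exact valid_of_mem h₁ _
    · exact valid_of_mem h₂ _
    · exact valid_of_mem h₃ _
    · simp [tuple, hv, hd]
    · simp [tuple, hv, hd]
    · simp [tuple, hv, hd.1.2.symm]
    · exact valid_of_mem (c := x) (by simp [hC, hx]) _)
  exact (h J).2.2.2.2 ⟨a, b, c, w₁, w₂, w₃, _, rfl, C, hC, hV, hJ, hk⟩

theorem card_support (hS : S.val = I.constraints) {c : OrdConstraint α × ℕ} (hc : c ∈ S) :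
    c.1.support.card = c.1.tuple.length :=
  List.toFinset_card_of_nodup (I.nodup c (hS ▸ hc))

theorem Irreducible.exists_tilt_pair (h : I.Irreducible) (hS : S.val = I.constraints) {u v : α}
    {w : ℕ} (hc : (two u v, w) ∈ S) :
    ∃ G : (α → ZMod 3) → ℚ, IsTilt (two u v).support G ∧
      1 / 27 ≤ tiltGain I.vars S (two u v).support G := by
  have hmem : ∀ c ∈ S, c ∈ I.constraints := fun c hc => hS ▸ hc
  have huv : u ≠ v := by simpa [tuple] using I.nodup _ (hmem _ hc)
  have hV : u ∈ I.vars ∧ v ∈ I.vars := by simpa [tuple] using I.mem_vars _ (hmem _ hc)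
  have hsupp : (two u v).support = {u, v} := by simp [support, tuple]
  refine ⟨fun y => pairTilt (y u) (y v), hsupp ▸ isTilt_pair huv, ?_⟩
  have hw : (1 : ℚ) ≤ w := by exact_mod_cast h.weight_pos (hmem _ hc)
  -- the opposite pair is absent, so every constraint on `u` and `v` is `two u v`
  have hone : ∀ c ∈ S, c.1.support = (two u v).support → c.1 = two u v := by
    rintro ⟨c, w'⟩ hc' hs
    have hlen := card_support hS hc'
    have hcard : ({u, v} : Finset α).card = 2 := card_pair huv
    rw [hs, hsupp, hcard] at hlen
    cases c with
    | two p q =>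
      have hpq : p ≠ q := by simpa [tuple] using I.nodup _ (hmem _ hc')
      rw [hsupp] at hs
      have hs' : ({p, q} : Finset α) = {u, v} := by simpa [support, tuple] using hs
      have hp : p = u ∨ p = v := by
        have : p ∈ ({u, v} : Finset α) := hs' ▸ (by simp)
        simpa using this
      have hq : q = u ∨ q = v := by
        have : q ∈ ({u, v} : Finset α) := hs' ▸ (by simp)
        simpa using this
      rcases hp with rfl | rfl <;> rcases hq with rfl | rfl
      · exact absurd rfl hpq
      · rfl
      · exact (h.not_opposite (hmem _ hc) (hmem _ hc')).elim
      · exact absurd rfl hpq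
    | three p q r => simp [tuple] at hlen
  have hval : ∀ c ∈ S.filter (fun c => c.1.support = (two u v).support),
      (c.2 : ℚ) * labelMean I.vars (fun y => pairTilt (y u) (y v) * (c.1.score y - c.1.mean)) =
        (c.2 : ℚ) * (1 / 9) := by
    intro c hc'
    rw [mem_filter] at hc'
    rw [hone c hc'.1 hc'.2, labelMean_pairTilt_mul hV.1 hV.2 huv]
  rw [tiltGain, sum_congr rfl hval]
  have hf : (two u v, w) ∈ S.filter (fun c => c.1.support = (two u v).support) :=
    mem_filter.2 ⟨hc, rfl⟩
  refine le_trans ?_ (single_le_sum (fun c _ => ?_) hf)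
  · linarith
  · positivity

/-- The weight of the ternary constraints on `e` with `v` in the middle. -/
def midWeight (S : Finset (OrdConstraint α × ℕ)) (e : Finset α) (v : α) : ℕ :=
  ∑ c ∈ S with c.1.support = e, if c.1.IsMid v then c.2 else 0

theorem exists_three_of_midWeight_pos {a b c : α} (hab : a ≠ b) (hac : a ≠ c) (hbc : b ≠ c)
    (h : 0 < midWeight S {a, b, c} b) :
    ∃ w, (three a b c, w) ∈ S ∨ (three c b a, w) ∈ S := by
  obtain ⟨⟨e, w⟩, he, hpos⟩ := exists_ne_zero_of_sum_ne_zero (Nat.pos_iff_ne_zero.1 h)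
  rw [mem_filter] at he
  have hmid : e.IsMid b := by
    by_contra hn
    exact hpos (if_neg hn)
  cases e with
  | two p q => exact hmid.elim
  | three p q r =>
    obtain rfl : q = b := hmid
    have hs : ({p, q, r} : Finset α) = {a, q, c} := by simpa [support, tuple] using he.2
    have ha : a ∈ ({p, q, r} : Finset α) := hs ▸ (by simp)
    have hc : c ∈ ({p, q, r} : Finset α) := hs ▸ (by simp)
    simp only [mem_insert, mem_singleton, hab, hbc.symm, false_or] at ha hc
    refine ⟨w, ?_⟩
    rcases ha with rfl | rfl <;> rcases hc with rfl | rfl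
    · exact absurd rfl hac
    · exact .inl he.1
    · exact .inr he.1
    · exact absurd rfl hac

/-- If each variable of a triple were in the middle with positive weight, the triple would carry
one constraint from each pair of mutually reverse orders. Any such choice of three orders is the
premise of the edge replacement rule or of the cycle replacement rule. -/
theorem Irreducible.midWeight_eq_zero (h : I.Irreducible) (hS : S.val = I.constraints) {a b c : α}
    (hab : a ≠ b) (hac : a ≠ c) (hbc : b ≠ c) :
    midWeight S {a, b, c} a = 0 ∨ midWeight S {a, b, c} b = 0 ∨ midWeight S {a, b, c} c = 0 := by
  by_contra! hpos
  obtain ⟨ha, hb, hc⟩ := hpos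
  have hmem : ∀ c ∈ S, c ∈ I.constraints := fun c hc => hS ▸ hc
  obtain ⟨w₂, h₂⟩ := exists_three_of_midWeight_pos hab hac hbc (Nat.pos_of_ne_zero hb)
  rw [show ({a, b, c} : Finset α) = {b, a, c} from insert_comm a b {c}] at ha
  rw [show ({a, b, c} : Finset α) = {a, c, b} by rw [pair_comm b c]] at hc
  obtain ⟨w₁, h₁⟩ := exists_three_of_midWeight_pos hab.symm hbc hac (Nat.pos_of_ne_zero ha)
  obtain ⟨w₃, h₃⟩ := exists_three_of_midWeight_pos hac hab hbc.symm (Nat.pos_of_ne_zero hc)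
  rcases h₁ with h₁ | h₁ <;> rcases h₂ with h₂ | h₂ <;> rcases h₃ with h₃ | h₃ <;>
    replace h₁ := hmem _ h₁ <;> replace h₂ := hmem _ h₂ <;> replace h₃ := hmem _ h₃
  · exact h.not_edge h₂ h₁ h₃
  · exact h.not_edge h₁ h₂ h₃
  · exact h.not_cycle h₁ h₃ h₂
  · exact h.not_edge h₃ h₂ h₁
  · exact h.not_edge h₃ h₁ h₂
  · exact h.not_cycle h₂ h₃ h₁
  · exact h.not_edge h₁ h₃ h₂
  · exact h.not_edge h₂ h₃ h₁

/-- Favouring `b` as the middle variable of a triple gains weight exactly if more than a third of the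
weight on the triple has `b` in the middle. -/
theorem tiltGain_triple {a b c : α} (ha : a ∈ I.vars) (hb : b ∈ I.vars)
    (hc : c ∈ I.vars) (hab : a ≠ b) (hac : a ≠ c) (hbc : b ≠ c) :
    27 * tiltGain I.vars S {a, b, c} (fun y => tripleTilt (y a) (y b) (y c)) =
      3 * midWeight S {a, b, c} b - (∑ e ∈ S with e.1.support = {a, b, c}, e.2 : ℕ) := by
  simp only [tiltGain, midWeight, Nat.cast_sum]
  rw [mul_sum, mul_sum, ← sum_sub_distrib]
  refine sum_congr rfl fun e he => ?_
  rw [labelMean_tripleTilt_mul ha hb hc hab hac hbc (mem_filter.1 he).2]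
  split_ifs <;> push_cast <;> ring

theorem Irreducible.exists_tilt_triple (h : I.Irreducible) (hS : S.val = I.constraints) {a b c : α}
    {w : ℕ} (he : (three a b c, w) ∈ S) :
    ∃ G : (α → ZMod 3) → ℚ, IsTilt (three a b c).support G ∧
      1 / 27 ≤ tiltGain I.vars S (three a b c).support G := by
  have hmem : ∀ c ∈ S, c ∈ I.constraints := fun c hc => hS ▸ hc
  have hd : (a ≠ b ∧ a ≠ c) ∧ b ≠ c := by simpa [tuple] using I.nodup _ (hmem _ he)
  obtain ⟨⟨hab, hac⟩, hbc⟩ := hd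
  have hV : a ∈ I.vars ∧ b ∈ I.vars ∧ c ∈ I.vars := by
    simpa [tuple] using I.mem_vars _ (hmem _ he)
  obtain ⟨ha, hb, hc⟩ := hV
  have hsupp : (three a b c).support = {a, b, c} := by simp [support, tuple]
  rw [hsupp]
  set T := ∑ e ∈ S with e.1.support = {a, b, c}, e.2 with hT
  have hTpos : 0 < T := (h.weight_pos (hmem _ he)).trans_le <|
    single_le_sum (f := fun e : OrdConstraint α × ℕ => e.2) (fun _ _ => Nat.zero_le _)
      (mem_filter.2 ⟨he, hsupp⟩)
  have hTle : T ≤ midWeight S {a, b, c} a + midWeight S {a, b, c} b + midWeight S {a, b, c} c := by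
    rw [hT, midWeight, midWeight, midWeight, ← sum_add_distrib, ← sum_add_distrib]
    refine sum_le_sum ?_
    rintro ⟨e, w'⟩ he'
    rw [mem_filter] at he'
    cases e with
    | two p q =>
      have hlen := card_support hS he'.1
      rw [he'.2, card_eq_three.2 ⟨a, b, c, hab, hac, hbc, rfl⟩] at hlen
      simp [tuple] at hlen
    | three p q r =>
      have hq : q = a ∨ q = b ∨ q = c := by
        have : q ∈ ({a, b, c} : Finset α) := he'.2 ▸ (by simp [support, tuple])
        simpa using this
      simp only [IsMid]
      rcases hq with rfl | rfl | rfl <;> simp <;> omega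
  have key : ∀ p q r : α, p ∈ I.vars → q ∈ I.vars → r ∈ I.vars → p ≠ q → p ≠ r → q ≠ r →
      ({a, b, c} : Finset α) = {p, q, r} → T < 3 * midWeight S {a, b, c} q →
      ∃ G : (α → ZMod 3) → ℚ, IsTilt {a, b, c} G ∧ 1 / 27 ≤ tiltGain I.vars S {a, b, c} G := by
    intro p q r hp hq hr hpq hpr hqr hs hlt
    rw [hs] at hT hlt ⊢
    refine ⟨_, isTilt_triple hpq hpr hqr, ?_⟩
    have hg := tiltGain_triple (S := S) hp hq hr hpq hpr hqr
    rw [← hT] at hg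
    have : (T : ℚ) + 1 ≤ 3 * midWeight S {p, q, r} q := by exact_mod_cast hlt
    linarith
  rcases lt_or_ge T (3 * midWeight S {a, b, c} a) with h1 | h1
  · exact key b a c hb ha hc hab.symm hbc hac (insert_comm a b {c}) h1
  rcases lt_or_ge T (3 * midWeight S {a, b, c} b) with h2 | h2
  · exact key a b c ha hb hc hab hac hbc rfl h2
  rcases lt_or_ge T (3 * midWeight S {a, b, c} c) with h3 | h3
  · exact key a c b ha hc hb hac hab hbc.symm (by rw [pair_comm b c]) h3
  have := h.midWeight_eq_zero hS hab hac hbc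
  omega

theorem Irreducible.exists_tilt (h : I.Irreducible) (hS : S.val = I.constraints)
    {c : OrdConstraint α × ℕ} (hc : c ∈ S) :
    ∃ G : (α → ZMod 3) → ℚ, IsTilt c.1.support G ∧ 1 / 27 ≤ tiltGain I.vars S c.1.support G := by
  obtain ⟨e, w⟩ := c
  cases e with
  | two u v => exact h.exists_tilt_pair hS hc
  | three a b c => exact h.exists_tilt_triple hS hc

end LinOrd3

/-! ### Maximal disjoint families outside a set -/

/-- If the members of `M` have at most `j + 1` elements outside `H`, then those outside parts that
have exactly `j + 1` elements can be hit by adding to `H` the members of a maximal disjoint family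
of them. -/
theorem exists_family_and_hitting_set {α : Type*} [DecidableEq α] (M : Finset (Finset α))
    (H : Finset α) {j : ℕ} (hM : ∀ e ∈ M, (e \ H).card ≤ j + 1) :
    ∃ F ⊆ M, (∀ e ∈ F, (e \ H).card = j + 1) ∧
      (F : Set (Finset α)).PairwiseDisjoint (· \ H) ∧
      ∃ H' : Finset α, H'.card ≤ H.card + F.card * (j + 1) ∧ ∀ e ∈ M, (e \ H').card ≤ j := by
  classical
  obtain ⟨F, hF, hmax⟩ := exists_max_image
    (M.powerset.filter fun F : Finset (Finset α) => (∀ e ∈ F, (e \ H).card = j + 1) ∧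
      (F : Set (Finset α)).PairwiseDisjoint (· \ H)) card ⟨∅, by simp⟩
  simp only [mem_filter, mem_powerset] at hF hmax
  obtain ⟨hFM, hFj, hdis⟩ := hF
  refine ⟨F, hFM, hFj, hdis, H ∪ F.biUnion (· \ H), ?_, fun e he => ?_⟩
  · exact (card_union_le _ _).trans
      (Nat.add_le_add_left (card_biUnion_le_card_mul _ _ _ fun e he => (hFj e he).le) _)
  · by_contra! hlt
    have hsub : e \ (H ∪ F.biUnion (· \ H)) ⊆ e \ H := sdiff_subset_sdiff le_rfl subset_union_left
    have heq := eq_of_subset_of_card_le hsub ((hM e he).trans hlt)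
    have hcard : (e \ H).card = j + 1 := le_antisymm (hM e he) (heq ▸ hlt)
    have hdisj : ∀ e' ∈ F, Disjoint (e \ H) (e' \ H) := by
      intro e' he'
      rw [← heq, disjoint_left]
      intro v hv hv'
      exact (mem_sdiff.1 hv).2 (mem_union_right _ (mem_biUnion.2 ⟨e', he', hv'⟩))
    have heF : e ∉ F := fun heF => by
      have := hdisj e heF
      rw [disjoint_self_iff_empty] at this
      rw [this, card_empty] at hcard
      omega
    have := hmax (insert e F) ⟨insert_subset he hFM, by
      simp only [mem_insert, forall_eq_or_imp]
      exact ⟨hcard, hFj⟩, by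
      rw [coe_insert]
      exact hdis.insert fun e' he' _ => hdisj e' he'⟩
    rw [card_insert_of_notMem heF] at this
    omega

/-! ### The bound on the number of variables -/

theorem mainTheorem7 {α : Type*} [DecidableEq α] (I : LinOrd3 α)
    (hirr : I.Irreducible) (hno : I.IsNo) :
    I.vars.card < 15 * I.k := by
  classical
  let S : Finset (OrdConstraint α × ℕ) := ⟨I.constraints, hirr.nodup_constraints⟩
  have hS : S.val = I.constraints := rfl
  -- the maximal variable sets of constraints
  let M : Finset (Finset α) := (S.image fun c => c.1.support).filter
    fun e => ∀ c ∈ S, e ⊆ c.1.support → c.1.support = e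
  have hMS : ∀ e ∈ M, ∃ c ∈ S, c.1.support = e := fun e he => by
    simpa using (mem_filter.1 he).1
  have hSM : ∀ c ∈ S, ∃ e ∈ M, c.1.support ⊆ e := by
    intro c hc
    obtain ⟨e, hce, he⟩ := (S.image fun c => c.1.support).exists_le_maximal
      (mem_image_of_mem (fun c => c.1.support) hc)
    exact ⟨e, mem_filter.2 ⟨he.1, fun c' hc' h =>
      le_antisymm (he.2 (mem_image_of_mem (fun c => c.1.support) hc') h) h⟩, hce⟩
  have hMV : ∀ e ∈ M, e ⊆ I.vars := fun e he => by
    obtain ⟨c, hc, rfl⟩ := hMS e he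
    exact LinOrd3.support_subset hS hc
  have htilt : ∀ e ∈ M, ∃ G : (α → ZMod 3) → ℚ, IsTilt e G ∧
      1 / 27 ≤ LinOrd3.tiltGain I.vars S e G := fun e he => by
    obtain ⟨c, hc, rfl⟩ := hMS e he
    exact hirr.exists_tilt hS hc
  choose! G hG hgain using htilt
  -- a no-instance has no large family with disjoint parts of maximal size outside `H`
  have hfam : ∀ (H : Finset α) (j : ℕ) (F : Finset (Finset α)), F ⊆ M →
      (∀ e ∈ M, (e \ H).card ≤ j + 1) → (∀ e ∈ F, (e \ H).card = j + 1) →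
      (F : Set (Finset α)).PairwiseDisjoint (· \ H) → 384 * F.card < 27 * I.k := by
    intro H j F hFM hM hFj hdis
    by_contra! hle
    obtain ⟨φ, hφ⟩ := LinOrd3.exists_ordering_of_tilts hS (F := F) (G := G) (q := 1 / 27)
      (fun e he => hG e (hFM he)) (fun e he => hMV e (hFM he))
      (fun e he => card_pos.1 (by rw [hFj e he]; omega)) hdis
      (fun c hc e he => by
        obtain ⟨e', he', hce'⟩ := hSM c hc
        rw [hFj e he]
        exact (card_le_card (sdiff_subset_sdiff hce' le_rfl)).trans (hM e' he'))
      (fun c hc e he => (mem_filter.1 (hFM he)).2 c hc)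
      (fun e he => hgain e (hFM he))
    refine hno ⟨φ, le_trans ?_ hφ⟩
    have : (27 : ℚ) * I.k ≤ 384 * F.card := by exact_mod_cast hle
    have h6 : (Nat.factorial 3 : ℚ) * 4 ^ 3 = 384 := by norm_num [Nat.factorial]
    rw [h6]
    linarith
  have hM₃ : ∀ e ∈ M, (e \ ∅).card ≤ 2 + 1 := fun e he => by
    obtain ⟨⟨c, w⟩, hc, rfl⟩ := hMS e he
    rw [sdiff_empty, LinOrd3.card_support hS hc]
    cases c <;> simp [OrdConstraint.tuple]
  obtain ⟨F₃, hF₃, hj₃, hd₃, H₂, hH₂, hM₂⟩ := exists_family_and_hitting_set M ∅ hM₃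
  obtain ⟨F₂, hF₂, hj₂, hd₂, H₁, hH₁, hM₁⟩ := exists_family_and_hitting_set M H₂ hM₂
  obtain ⟨F₁, hF₁, hj₁, hd₁, H₀, hH₀, hM₀⟩ := exists_family_and_hitting_set M H₁ hM₁
  have hV : I.vars ⊆ H₀ := by
    intro v hv
    obtain ⟨c, hc, hvc⟩ := hirr.exists_mem_tuple hv
    obtain ⟨e, he, hce⟩ := hSM c hc
    have h0 : e ⊆ H₀ := sdiff_eq_empty_iff_subset.1 (card_eq_zero.1 (Nat.le_zero.1 (hM₀ e he)))
    exact h0 (hce (by simpa [OrdConstraint.support] using hvc))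
  have h₃ := hfam ∅ 2 F₃ hF₃ hM₃ hj₃ hd₃
  have h₂ := hfam H₂ 1 F₂ hF₂ hM₂ hj₂ hd₂
  have h₁ := hfam H₁ 0 F₁ hF₁ hM₁ hj₁ hd₁
  have hcard := card_le_card hV
  rw [card_empty] at hH₂
  omega
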